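/- Let $m\ge 1$ be an integer, let $\alpha>0$, $\beta\ge 0$ with $\alpha+\beta\le 1$, and let $\overline\gamma>0$. Let $\gamma\sim\mathcal F_{\rm SOSF}(\alpha,\beta,m;\overline\gamma)$ (the fluctuating SOSF law), i.e. $\gamma$ is distributed as $\overline\gamma|S|^2$ with $$S=\omega_0\sqrt{\xi}\,e^{i\phi}+\omega_1G_1+\omega_2G_2G_3,$$ where $\xi,\phi,G_1,G_2,G_3$ are independent, $\xi$ has the Gamma density $m^m u^{m-1}e^{-mu}/\Gamma(m)$ on $u>0$, $\phi$ is uniform on $[0,2\pi)$, each $G_i$ is a standard circularly symmetric complex normal variable ($\mathbb E|G_i|^2=1$), and $\omega_0,\omega_1,\omega_2$ are real constants with $\omega_0^2+\omega_1^2+\omega_2^2=1$, $\alpha=\omega_2^2$, $\beta=\omega_0^2$. Put $c=\frac{m(1-\alpha-\beta)+\beta}{m\alpha}$ and $\Gamma(a,z,b)=\int_z^\infty t^{a-1}e^{-t}e^{-b/t}\,dt$. Then for every real $g\ge 0$ the CDF of $\gamma$ is $$F_\gamma(g)=1-e^{c}\sum_{j=0}^{m-1}\sum_{r=0}^{m-j-1}\sum_{q=0}^{j}\binom{m-1}{j}\binom{j}{q}\frac{(-1)^{j-q}\alpha^{q-r-m+1}}{r!}\left(\frac{g}{\overline\gamma}\right)^{r}\left(\frac{\beta}{m}\right)^{m-q-1}\Gamma\left(q-r-m+2,\;c,\;\frac{g}{\alpha\overline\gamma}\right),$$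 with the convention $0^0=1$. All the integrals $\Gamma(\cdot,\cdot,\cdot)$ in this formula converge, except that when $\alpha=1$ and $g=0$ those that are multiplied by a zero coefficient may diverge; such terms are read as $0$. -/

import Mathlib

open MeasureTheory ProbabilityTheory

noncomputable section

namespace FSOSF

/-- The circularly symmetric complex normal law `N_c(0, 1)`: independent real and imaginary parts,
each centred normal with variance `1 / 2`, so that `E |G|^2 = 1`. -/
def complexNormal : Measure ℂ :=
  ((gaussianReal 0 (1 / 2)).prod (gaussianReal 0 (1 / 2))).map
    (fun p : ℝ × ℝ => (p.1 : ℂ) + (p.2 : ℂ) * Complex.I)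

/-- The uniform law on `[0, 2π)`. -/
def uniformPhase : Measure ℝ :=
  ProbabilityTheory.cond volume (Set.Ico 0 (2 * Real.pi))

/-- The joint law of the independent variables `(ξ, φ, G₁, G₂, G₃)`. The law of `ξ` is the Gamma
law of shape `m` and mean one (that is, rate `m`), whose density on `u > 0` is
`m ^ m * u ^ (m - 1) * exp (-m * u) / Γ(m)`. -/
def sourceLaw (m : ℝ) : Measure (ℝ × ℝ × ℂ × ℂ × ℂ) :=
  (gammaMeasure m m).prod
    (uniformPhase.prod (complexNormal.prod (complexNormal.prod complexNormal)))

/-- The received signal `S = ω₀ √ξ e^{iφ} + ω₁ G₁ + ω₂ G₂ G₃`. -/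
def signal (ω₀ ω₁ ω₂ : ℝ) (p : ℝ × ℝ × ℂ × ℂ × ℂ) : ℂ :=
  match p with
  | (ξ, φ, G₁, G₂, G₃) =>
    (ω₀ : ℂ) * (Real.sqrt ξ : ℂ) * Complex.exp ((φ : ℂ) * Complex.I)
      + (ω₁ : ℂ) * G₁ + (ω₂ : ℂ) * G₂ * G₃

/-- The law of the instantaneous SNR `γbar * |S|^2`. -/
def snrLaw (ω₀ ω₁ ω₂ m γbar : ℝ) : Measure ℝ :=
  (sourceLaw m).map (fun p => γbar * ‖signal ω₀ ω₁ ω₂ p‖ ^ 2)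

/-- `IsFSOSF α β m γbar X μ` says that the random variable `X` on `(Ω, μ)` is fluctuating-SOSF
distributed with shape parameters `α, β, m` and average SNR `γbar`: it is distributed as
`γbar * |S|^2` for the normalized signal `S` whose weights `ω₀, ω₁, ω₂` correspond
to `(α, β)`. -/
def IsFSOSF {Ω : Type*} [MeasurableSpace Ω] (α β m γbar : ℝ) (X : Ω → ℝ) (μ : Measure Ω) : Prop :=
  ∃ ω₀ ω₁ ω₂ : ℝ,
    ω₀ ^ 2 + ω₁ ^ 2 + ω₂ ^ 2 = 1 ∧
    α = ω₂ ^ 2 / (ω₀ ^ 2 + ω₁ ^ 2 + ω₂ ^ 2) ∧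
    β = ω₀ ^ 2 / (ω₀ ^ 2 + ω₁ ^ 2 + ω₂ ^ 2) ∧
    HasLaw X (snrLaw ω₀ ω₁ ω₂ m γbar) μ

/-- The integrand `t ^ (a - 1) * e ^ (-t) * e ^ (-b / t)`. -/
def genIncGammaIntegrand (a b t : ℝ) : ℝ :=
  t ^ (a - 1) * Real.exp (-t) * Real.exp (-b / t)

/-- The generalized incomplete gamma function
`Γ(a, z, b) = ∫_z^∞ t ^ (a - 1) e ^ (-t) e ^ (-b / t) dt`. -/
def genIncGamma (a z b : ℝ) : ℝ :=
  ∫ t in Set.Ioi z, genIncGammaIntegrand a b t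

end FSOSF

end

/-!
Condition on `G₃ = z`. Given `z`, the variable `ω₂ G₂ z` is again a circular complex Gaussian, so with
`v = ω₁² + ω₂² |z|²` and `w = v + ω₀² / m` the signal is a Rician amplitude whose line of sight
fluctuates by a Gamma law. The transform `E exp(σ |S|²)`, for `Re σ ≤ 0`, follows by integrating the
sources out one at a time: the Gaussian identity `integral_cexp_complexNormal` handles `G₂` and then
`G₁`, the phase `φ` disappears because only the modulus of the line of sight is left, and the Gamma
integral handles `ξ`. The result is `(1 - σ v)^(m - 1) / (1 - σ w)^m` (`integral_cexp_partialSignal`).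

Because `m` is an integer, writing `1 - σ v = (v / w) (1 - σ w) + (1 - v / w)` and expanding the
`(m - 1)`-st power exhibits this as the transform of a binomial mixture of Gamma laws of shapes
`m - j` and scale `w`. Uniqueness of characteristic functions identifies the conditional law of
`|S|²` (`map_partialSignal_eq_sum`), and the Erlang tail (`gammaMeasure_real_Ioi`) gives its
conditional tail.

The remaining average is over `|G₃|²`, which is a standard exponential variable `x`
(`map_norm_sq_complexNormal`). There `w = α (x + c)` and `v = w - β / m`; expanding `v ^ j` by the
binomial theorem and substituting `t = x + c` turns every term into a generalized incomplete Gamma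
integral (`exp_mul_sum_eq_sum_genIncGammaIntegrand`). All of these converge if `c > 0` or `b > 0`
(`integrableOn_genIncGammaIntegrand`); in the one remaining case, `α = 1` at the origin, the only
term with a nonzero coefficient is `∫₀^∞ e^{-t} dt`.
-/

namespace FSOSF

open Filter Topology

section Transforms

open Complex

/-! ### Gamma laws of integer shape -/

lemma integrableOn_pow_mul_cexp_neg_mul (n : ℕ) {a : ℂ} (ha : 0 < a.re) :
    IntegrableOn (fun x : ℝ ↦ (x : ℂ) ^ n * cexp (-a * x)) (Set.Ioi 0) := by
  have h := integrableOn_rpow_mul_exp_neg_mul_rpow (p := 1) (s := n) (b := a.re)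
    (by linarith [n.cast_nonneg (α := ℝ)]) one_pos ha
  refine h.mono' (by fun_prop) ?_
  refine (ae_restrict_iff' measurableSet_Ioi).2 (ae_of_all _ fun x hx ↦ ?_)
  have hx : 0 < x := hx
  simp [Complex.norm_exp, abs_of_pos hx]

lemma tendsto_pow_mul_cexp_neg_mul (n : ℕ) {a : ℂ} (ha : 0 < a.re) :
    Tendsto (fun x : ℝ ↦ (x : ℂ) ^ n * cexp (-a * x)) atTop (𝓝 0) := by
  rw [tendsto_zero_iff_norm_tendsto_zero]
  have h := tendsto_rpow_mul_exp_neg_mul_atTop_nhds_zero n a.re ha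
  refine h.congr' ?_
  filter_upwards [eventually_gt_atTop 0] with x hx
  simp [Complex.norm_exp, abs_of_pos hx]

/-- The integral `∫₀^∞ xⁿ e^{-ax} dx = n! / a^{n+1}` for a complex rate `a`. -/
lemma integral_pow_mul_cexp_neg_mul (n : ℕ) {a : ℂ} (ha : 0 < a.re) :
    ∫ x in Set.Ioi (0 : ℝ), (x : ℂ) ^ n * cexp (-a * x) = n.factorial / a ^ (n + 1) := by
  have ha0 : a ≠ 0 := by rintro rfl; simp at ha
  induction n with
  | zero =>
    have h := integral_exp_mul_complex_Ioi (a := -a) (by simpa using ha) 0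
    simpa [neg_div_neg_eq] using h
  | succ n ih =>
    have hd (x : ℝ) : HasDerivAt (fun x : ℝ ↦ (x : ℂ) ^ (n + 1) * cexp (-a * x))
        ((n + 1) * ((x : ℂ) ^ n * cexp (-a * x)) - a * ((x : ℂ) ^ (n + 1) * cexp (-a * x))) x := by
      have h1 : HasDerivAt (fun z : ℂ ↦ z ^ (n + 1) * cexp (-a * z))
          ((n + 1) * ((x : ℂ) ^ n * cexp (-a * x)) - a * ((x : ℂ) ^ (n + 1) * cexp (-a * x)))
          (x : ℂ) := by
        convert! (hasDerivAt_pow (n + 1) (x : ℂ)).mul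
          (((hasDerivAt_id (x : ℂ)).const_mul (-a)).cexp) using 1
        simp
        ring
      exact h1.comp_ofReal
    have i1 := (integrableOn_pow_mul_cexp_neg_mul n ha).const_mul ((n : ℂ) + 1)
    have i2 := (integrableOn_pow_mul_cexp_neg_mul (n + 1) ha).const_mul a
    have h := integral_Ioi_of_hasDerivAt_of_tendsto' (a := 0) (fun x _ ↦ hd x) (i1.sub i2)
      (tendsto_pow_mul_cexp_neg_mul (n + 1) ha)
    have e := integral_sub i1 i2
    rw [e, integral_const_mul, integral_const_mul, ih] at h
    simp only [ofReal_zero, ne_eq, Nat.add_eq_zero_iff, one_ne_zero, and_false, not_false_eq_true,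
      zero_pow, zero_mul, sub_zero, sub_eq_zero] at h
    have := congrArg (fun z ↦ a⁻¹ * z) h
    simp only [inv_mul_cancel_left₀ ha0] at this
    rw [← this, Nat.factorial_succ, pow_succ a (n + 1)]
    push_cast
    field_simp

/-- Integration against a Gamma law of integer shape. -/
lemma integral_gammaMeasure_natCast (n : ℕ) {ρ : ℝ} (hρ : 0 < ρ) {E : Type*}
    [NormedAddCommGroup E] [NormedSpace ℝ E] (f : ℝ → E) :
    ∫ x, f x ∂(gammaMeasure (n + 1 : ℕ) ρ) =
      ∫ x in Set.Ioi 0, (ρ ^ (n + 1) / n.factorial * x ^ n * Real.exp (-(ρ * x))) • f x := by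
  have hn : (0 : ℝ) < (n + 1 : ℕ) := by positivity
  have hm : Measurable (gammaPDF (n + 1 : ℕ) ρ) := by unfold gammaPDF; fun_prop
  rw [gammaMeasure, integral_withDensity_eq_integral_toReal_smul hm
    (ae_of_all _ fun _ ↦ ENNReal.ofReal_lt_top), ← integral_Ici_eq_integral_Ioi,
    ← setIntegral_eq_integral_of_forall_compl_eq_zero (s := Set.Ici 0)]
  · refine setIntegral_congr_fun measurableSet_Ici fun x hx ↦ ?_
    have hx : 0 ≤ x := hx
    rw [gammaPDF, ENNReal.toReal_ofReal (gammaPDFReal_nonneg hn hρ x), gammaPDFReal, if_pos hx]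
    congr 3
    · rw [Real.rpow_natCast, Nat.cast_succ, Real.Gamma_nat_eq_factorial]
    · rw [Nat.cast_succ, add_sub_cancel_right, Real.rpow_natCast]
  · intro x hx
    rw [gammaPDF_of_neg (by simpa using hx)]
    simp

/-- The Laplace transform of a Gamma law of integer shape, at a complex argument. -/
lemma integral_cexp_gammaMeasure {k : ℕ} (hk : 0 < k) {ρ : ℝ} (hρ : 0 < ρ) {σ : ℂ}
    (hσ : σ.re ≤ 0) :
    ∫ x : ℝ, cexp (σ * x) ∂(gammaMeasure k ρ) = ((1 - σ / ρ) ^ k)⁻¹ := by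
  obtain ⟨n, rfl⟩ : ∃ n, k = n + 1 := ⟨k - 1, by omega⟩
  have ha : 0 < (ρ - σ : ℂ).re := by simp; linarith
  have ha0 : (ρ - σ : ℂ) ≠ 0 := by intro h; simp [h] at ha
  have hρ0 : (ρ : ℂ) ≠ 0 := by exact_mod_cast hρ.ne'
  rw [integral_gammaMeasure_natCast n hρ]
  have (x : ℝ) : (ρ ^ (n + 1) / n.factorial * x ^ n * Real.exp (-(ρ * x))) • cexp (σ * x) =
      (ρ ^ (n + 1) / n.factorial : ℂ) * ((x : ℂ) ^ n * cexp (-(ρ - σ) * x)) := by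
    rw [Complex.real_smul]
    push_cast
    rw [show -((ρ : ℂ) - σ) * x = -(ρ * x) + σ * x by ring, Complex.exp_add]
    ring
  simp_rw [this]
  rw [integral_const_mul, integral_pow_mul_cexp_neg_mul n ha,
    show (1 - σ / ρ : ℂ) = (ρ - σ) / ρ by field_simp, div_pow, inv_div]
  have : (n.factorial : ℂ) ≠ 0 := by exact_mod_cast n.factorial_ne_zero
  field_simp

lemma hasDerivAt_exp_neg_mul_sum (n : ℕ) (ρ x : ℝ) :
    HasDerivAt (fun x ↦ -(Real.exp (-(ρ * x)) *
        ∑ r ∈ Finset.range (n + 1), (ρ * x) ^ r / (r.factorial : ℝ)))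
      (ρ ^ (n + 1) / n.factorial * x ^ n * Real.exp (-(ρ * x))) x := by
  have he : HasDerivAt (fun x ↦ Real.exp (-(ρ * x))) (Real.exp (-(ρ * x)) * (-ρ)) x := by
    simpa using (((hasDerivAt_id x).const_mul ρ).neg).exp
  have hp (r : ℕ) : HasDerivAt (fun x ↦ (ρ * x) ^ (r + 1) / ((r + 1).factorial : ℝ))
      (ρ * ((ρ * x) ^ r / r.factorial)) x := by
    convert! ((((hasDerivAt_id x).const_mul ρ).pow (r + 1)).div_const ((r + 1).factorial : ℝ))
      using 1
    simp [Nat.factorial_succ]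
    field_simp
  have hs : HasDerivAt (fun x ↦ ∑ r ∈ Finset.range (n + 1), (ρ * x) ^ r / (r.factorial : ℝ))
      (ρ * ∑ r ∈ Finset.range n, (ρ * x) ^ r / (r.factorial : ℝ)) x := by
    simp_rw [Finset.sum_range_succ', Finset.mul_sum]
    simpa using (HasDerivAt.fun_sum fun r (_ : r ∈ Finset.range n) ↦ hp r).add_const (1 : ℝ)
  convert! (he.mul hs).neg using 1
  rw [Finset.sum_range_succ, mul_pow]
  ring

/-- The tail of a Gamma law of integer shape (the Erlang law). -/
lemma gammaMeasure_real_Ioi {k : ℕ} (hk : 0 < k) {ρ : ℝ} (hρ : 0 < ρ) {g : ℝ} (hg : 0 ≤ g) :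
    (gammaMeasure k ρ).real (Set.Ioi g) =
      Real.exp (-(ρ * g)) * ∑ r ∈ Finset.range k, (ρ * g) ^ r / (r.factorial : ℝ) := by
  obtain ⟨n, rfl⟩ : ∃ n, k = n + 1 := ⟨k - 1, by omega⟩
  have ht : Tendsto (fun x ↦ -(Real.exp (-(ρ * x)) *
      ∑ r ∈ Finset.range (n + 1), (ρ * x) ^ r / (r.factorial : ℝ))) atTop (𝓝 0) := by
    rw [← neg_zero]
    refine Tendsto.neg ?_
    simp_rw [Finset.mul_sum]
    rw [← Finset.sum_const_zero (s := Finset.range (n + 1))]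
    refine tendsto_finsetSum _ fun r _ ↦ ?_
    have h1 := ((Real.tendsto_pow_mul_exp_neg_atTop_nhds_zero r).div_const
      (r.factorial : ℝ)).comp (tendsto_id.const_mul_atTop hρ)
    rw [zero_div] at h1
    refine h1.congr fun x ↦ ?_
    simp only [Function.comp, id]
    ring
  have h := integral_Ioi_of_hasDerivAt_of_nonneg' (a := g)
    (fun x _ ↦ hasDerivAt_exp_neg_mul_sum n ρ x) (fun x hx ↦ by
      have : 0 < x := hg.trans_lt hx
      positivity) ht
  rw [← integral_indicator_one measurableSet_Ioi, integral_gammaMeasure_natCast n hρ]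
  have (x : ℝ) : (ρ ^ (n + 1) / n.factorial * x ^ n * Real.exp (-(ρ * x))) •
      (Set.Ioi g).indicator (1 : ℝ → ℝ) x = (Set.Ioi g).indicator
        (fun x ↦ ρ ^ (n + 1) / n.factorial * x ^ n * Real.exp (-(ρ * x))) x := by
    by_cases hx : x ∈ Set.Ioi g <;> simp [hx]
  simp_rw [this]
  rw [setIntegral_indicator measurableSet_Ioi, Set.inter_eq_right.2 (Set.Ioi_subset_Ioi hg), h]
  simp

/-! ### Gaussian averages -/

/-- The Gaussian integral `E exp(b x² + c x)` for `x` centred normal with variance `1 / 2`. The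
principal square root is left unsimplified, since only its square matters in the plane. -/
lemma integral_cexp_gaussianReal {b : ℂ} (hb : b.re < 1) (c : ℂ) :
    ∫ x : ℝ, cexp (b * x ^ 2 + c * x) ∂(gaussianReal 0 (1 / 2)) =
      (√Real.pi : ℂ)⁻¹ * (Real.pi / (1 - b)) ^ (1 / 2 : ℂ) * cexp (c ^ 2 / (4 * (1 - b))) := by
  rw [integral_gaussianReal_eq_integral_smul (by simp)]
  have (x : ℝ) : gaussianPDFReal 0 (1 / 2) x • cexp (b * x ^ 2 + c * x) =
      ((√Real.pi)⁻¹ : ℝ) * cexp ((b - 1) * x ^ 2 + c * x + 0) := by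
    rw [Complex.real_smul, gaussianPDFReal]
    have e1 : (2 : ℝ) * Real.pi * ((1 / 2 : NNReal) : ℝ) = Real.pi := by push_cast; ring
    have e2 : -(x - 0) ^ 2 / (2 * ((1 / 2 : NNReal) : ℝ)) = -x ^ 2 := by push_cast; ring
    rw [e1, e2]
    push_cast
    rw [show (b - 1) * x ^ 2 + c * x + 0 = -(x : ℂ) ^ 2 + (b * x ^ 2 + c * x) by ring,
      Complex.exp_add (-(x : ℂ) ^ 2), mul_assoc]
  simp_rw [this]
  rw [integral_const_mul, integral_cexp_quadratic (by simpa using hb), neg_sub, ofReal_inv,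
    mul_assoc, show b - 1 = -(1 - b) by ring]
  congr 3
  rw [mul_neg, div_neg]
  ring

instance : IsProbabilityMeasure complexNormal := by
  unfold complexNormal
  exact Measure.isProbabilityMeasure_map (by fun_prop)

instance : IsProbabilityMeasure uniformPhase :=
  cond_isProbabilityMeasure_of_finite (by simp [Real.pi_pos]) measure_Ico_lt_top.ne

/-- Averaging over a circular complex Gaussian turns `b ↦ exp(σ |b|²)` into a multiple of a function
of the same kind. Hence this one identity computes both Gaussian averages of the signal, one after
the other, and the law of `|G|²`. -/
lemma integral_cexp_complexNormal {σ : ℂ} (hσ : σ.re ≤ 0) (b κ : ℂ) :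
    ∫ G, cexp (σ * (‖b + κ * G‖ ^ 2 : ℝ)) ∂complexNormal =
      (1 - σ * (‖κ‖ ^ 2 : ℝ))⁻¹ * cexp (σ / (1 - σ * (‖κ‖ ^ 2 : ℝ)) * (‖b‖ ^ 2 : ℝ)) := by
  have hre : (σ * (‖κ‖ ^ 2 : ℝ)).re < 1 := by
    rw [re_mul_ofReal]
    nlinarith [sq_nonneg ‖κ‖]
  set k : ℂ := σ * (‖κ‖ ^ 2 : ℝ) with hk
  have h1 : (1 - k : ℂ) ≠ 0 := by
    intro h
    have := congrArg Complex.re h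
    simp at this
    linarith
  -- `b̄ κ = p - i r`, so that `|b + κ (x + iy)|² = |b|² + 2 (p x + r y) + |κ|² (x² + y²)`
  set p : ℝ := b.re * κ.re + b.im * κ.im
  set r : ℝ := b.im * κ.re - b.re * κ.im
  have hpr : p ^ 2 + r ^ 2 = ‖b‖ ^ 2 * ‖κ‖ ^ 2 := by
    rw [← normSq_eq_norm_sq, ← normSq_eq_norm_sq, normSq_apply, normSq_apply]
    ring
  have hsplit (z : ℝ × ℝ) : cexp (σ * (‖b + κ * ((z.1 : ℂ) + (z.2 : ℂ) * I)‖ ^ 2 : ℝ)) =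
      cexp (σ * (‖b‖ ^ 2 : ℝ)) * (cexp (k * z.1 ^ 2 + (2 * σ * p) * z.1) *
        cexp (k * z.2 ^ 2 + (2 * σ * r) * z.2)) := by
    rw [← Complex.exp_add, ← Complex.exp_add]
    congr 1
    have : ‖b + κ * ((z.1 : ℂ) + (z.2 : ℂ) * I)‖ ^ 2 =
        ‖b‖ ^ 2 + 2 * (p * z.1 + r * z.2) + ‖κ‖ ^ 2 * (z.1 ^ 2 + z.2 ^ 2) := by
      rw [← normSq_eq_norm_sq, ← normSq_eq_norm_sq, ← normSq_eq_norm_sq, normSq_apply,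
        normSq_apply, normSq_apply]
      simp
      ring
    rw [this, hk]
    push_cast
    ring
  have hsq : (√Real.pi : ℂ)⁻¹ * (Real.pi / (1 - k)) ^ (1 / 2 : ℂ) *
      ((√Real.pi : ℂ)⁻¹ * (Real.pi / (1 - k)) ^ (1 / 2 : ℂ)) = (1 - k)⁻¹ := by
    have hpi : (Real.pi : ℂ) ≠ 0 := by exact_mod_cast Real.pi_ne_zero
    have e1 : ((√Real.pi : ℝ) : ℂ) * (√Real.pi : ℝ) = Real.pi := by
      rw [← ofReal_mul, Real.mul_self_sqrt Real.pi_pos.le]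
    rw [mul_mul_mul_comm, ← mul_inv, e1, ← cpow_add _ _ (div_ne_zero hpi h1)]
    norm_num
    field_simp
  rw [complexNormal, integral_map (by fun_prop) (by fun_prop)]
  simp_rw [hsplit]
  rw [integral_const_mul, integral_prod_mul (fun x : ℝ ↦ cexp (k * x ^ 2 + (2 * σ * p) * x))
      (fun x : ℝ ↦ cexp (k * x ^ 2 + (2 * σ * r) * x)),
    integral_cexp_gaussianReal hre, integral_cexp_gaussianReal hre,
    mul_mul_mul_comm, hsq, mul_left_comm, ← Complex.exp_add, ← Complex.exp_add]
  congr 2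
  have hpr' : (p : ℂ) ^ 2 + (r : ℂ) ^ 2 = (‖b‖ ^ 2 : ℝ) * (‖κ‖ ^ 2 : ℝ) := by
    exact_mod_cast hpr
  have : (2 * σ * p) ^ 2 / (4 * (1 - k)) + (2 * σ * r) ^ 2 / (4 * (1 - k)) =
      σ * k * (‖b‖ ^ 2 : ℝ) / (1 - k) := by
    rw [← add_div, show (2 * σ * p) ^ 2 + (2 * σ * r) ^ 2 = 4 * (σ ^ 2 * (p ^ 2 + r ^ 2)) by ring,
      hpr', hk]
    field_simp
  rw [this]
  field_simp
  ring

/-! ### Sampling `G₃` separately -/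

/-- The joint law of the variables `(ξ, φ, G₁, G₂)`, that is, of all sources except `G₃`. -/
noncomputable def partialSourceLaw (m : ℝ) : Measure (ℝ × ℝ × ℂ × ℂ) :=
  (gammaMeasure m m).prod (uniformPhase.prod (complexNormal.prod complexNormal))

/-- The signal as a function of `(ξ, φ, G₁, G₂)`, for a frozen value `z` of `G₃`. -/
noncomputable def partialSignal (ω₀ ω₁ ω₂ : ℝ) (z : ℂ) (p : ℝ × ℝ × ℂ × ℂ) : ℂ :=
  signal ω₀ ω₁ ω₂ (p.1, p.2.1, p.2.2.1, p.2.2.2, z)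

@[fun_prop]
lemma measurable_signal (ω₀ ω₁ ω₂ : ℝ) : Measurable (signal ω₀ ω₁ ω₂) := by
  unfold signal
  fun_prop

@[fun_prop]
lemma measurable_partialSignal (ω₀ ω₁ ω₂ : ℝ) (z : ℂ) :
    Measurable (partialSignal ω₀ ω₁ ω₂ z) := by
  unfold partialSignal
  fun_prop

lemma isProbabilityMeasure_partialSourceLaw {m : ℝ} (hm : 0 < m) :
    IsProbabilityMeasure (partialSourceLaw m) := by
  have := isProbabilityMeasure_gammaMeasure hm hm
  unfold partialSourceLaw
  infer_instance

lemma isProbabilityMeasure_sourceLaw {m : ℝ} (hm : 0 < m) :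
    IsProbabilityMeasure (sourceLaw m) := by
  have := isProbabilityMeasure_gammaMeasure hm hm
  unfold sourceLaw
  infer_instance

/-- Since `G₃` is independent of the other sources, it may be sampled first. -/
lemma measurePreserving_partialSourceLaw {m : ℝ} (hm : 0 < m) :
    MeasurePreserving (fun q : ℂ × ℝ × ℝ × ℂ × ℂ ↦
        ((q.2.1, q.2.2.1, q.2.2.2.1, q.2.2.2.2, q.1) : ℝ × ℝ × ℂ × ℂ × ℂ))
      (complexNormal.prod (partialSourceLaw m)) (sourceLaw m) := by
  have := isProbabilityMeasure_gammaMeasure hm hm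
  have := isProbabilityMeasure_partialSourceLaw hm
  have h1 : MeasurePreserving Prod.swap (complexNormal.prod (partialSourceLaw m))
    ((partialSourceLaw m).prod complexNormal) := Measure.measurePreserving_swap
  have h2 := measurePreserving_prodAssoc (gammaMeasure m m)
    (uniformPhase.prod (complexNormal.prod complexNormal)) complexNormal
  have h3 := (MeasurePreserving.id (gammaMeasure m m)).prod
    (measurePreserving_prodAssoc uniformPhase (complexNormal.prod complexNormal) complexNormal)
  have h4 := (MeasurePreserving.id (gammaMeasure m m)).prod
    ((MeasurePreserving.id uniformPhase).prod
      (measurePreserving_prodAssoc complexNormal complexNormal complexNormal))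
  exact h4.comp (h3.comp (h2.comp h1))

/-! ### The conditional law of `|S|²` given `G₃` -/

lemma one_sub_mul_ofReal_ne_zero {σ : ℂ} (hσ : σ.re ≤ 0) {k : ℝ} (hk : 0 ≤ k) :
    1 - σ * k ≠ 0 := by
  intro h
  have := congrArg Complex.re h
  simp at this
  nlinarith

/-- The Möbius maps `σ ↦ σ / (1 - kσ)` with `k ≥ 0` preserve the closed left half-plane. -/
lemma re_div_one_sub_mul_nonpos {σ : ℂ} (hσ : σ.re ≤ 0) {k : ℝ} (hk : 0 ≤ k) :
    (σ / (1 - σ * k)).re ≤ 0 := by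
  rw [Complex.div_re, ← add_div]
  refine div_nonpos_of_nonpos_of_nonneg ?_ (normSq_nonneg _)
  simp
  nlinarith [mul_nonneg hk (sq_nonneg σ.re), mul_nonneg hk (sq_nonneg σ.im)]

lemma norm_cexp_mul_ofReal_le {σ : ℂ} (hσ : σ.re ≤ 0) {x : ℝ} (hx : 0 ≤ x) :
    ‖cexp (σ * x)‖ ≤ 1 := by
  rw [Complex.norm_exp, re_mul_ofReal]
  exact Real.exp_le_one_iff.2 (mul_nonpos_of_nonpos_of_nonneg hσ hx)

/-- The Laplace transform of `|S|²` for a frozen value `z` of `G₃`. With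
`v = ω₁² + ω₂² |z|²` and `w = v + ω₀² / m`, it is `(1 - σ v)^(m - 1) / (1 - σ w)^m`. -/
lemma integral_cexp_partialSignal {m : ℕ} (hm : 0 < m) (ω₀ ω₁ ω₂ : ℝ) (z : ℂ) {σ : ℂ}
    (hσ : σ.re ≤ 0) {v w : ℝ} (hv : v = ω₁ ^ 2 + ω₂ ^ 2 * ‖z‖ ^ 2) (hw : w = v + ω₀ ^ 2 / m) :
    ∫ p, cexp (σ * (‖partialSignal ω₀ ω₁ ω₂ z p‖ ^ 2 : ℝ)) ∂(partialSourceLaw m) =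
      (1 - σ * v) ^ (m - 1) / (1 - σ * w) ^ m := by
  have hm0 : (0 : ℝ) < m := by exact_mod_cast hm
  have := isProbabilityMeasure_gammaMeasure hm0 hm0
  have hv0 : 0 ≤ v := by rw [hv]; positivity
  have hmeas : Measurable (fun p ↦ cexp (σ * (‖partialSignal ω₀ ω₁ ω₂ z p‖ ^ 2 : ℝ))) := by
    fun_prop
  have hint : Integrable (fun p ↦ cexp (σ * (‖partialSignal ω₀ ω₁ ω₂ z p‖ ^ 2 : ℝ)))
      (partialSourceLaw m) := by
    have := isProbabilityMeasure_partialSourceLaw hm0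
    exact Integrable.of_bound (by fun_prop) 1
      (ae_of_all _ fun p ↦ norm_cexp_mul_ofReal_le hσ (sq_nonneg _))
  set k : ℝ := ω₂ ^ 2 * ‖z‖ ^ 2 with hk
  have hk0 : 0 ≤ k := by positivity
  have hσ1 := re_div_one_sub_mul_nonpos hσ hk0
  have n1 := one_sub_mul_ofReal_ne_zero hσ hk0
  have n2 := one_sub_mul_ofReal_ne_zero hσ hv0
  -- the average over `φ, G₁, G₂` at a frozen `ξ`
  have hinner (ξ : ℝ) (hξ : 0 ≤ ξ) :
      ∫ p : ℝ × ℂ × ℂ, cexp (σ * (‖partialSignal ω₀ ω₁ ω₂ z (ξ, p)‖ ^ 2 : ℝ))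
        ∂(uniformPhase.prod (complexNormal.prod complexNormal)) =
      (1 - σ * v)⁻¹ * cexp (σ / (1 - σ * v) * (ω₀ ^ 2 : ℝ) * ξ) := by
    rw [integral_prod _ (Integrable.of_bound
      (by exact (hmeas.comp measurable_prodMk_left).aestronglyMeasurable) 1
      (ae_of_all _ fun p ↦ norm_cexp_mul_ofReal_le hσ (sq_nonneg _)))]
    have hφ (φ : ℝ) : ∫ q : ℂ × ℂ, cexp (σ * (‖partialSignal ω₀ ω₁ ω₂ z (ξ, φ, q)‖ ^ 2 : ℝ))
        ∂(complexNormal.prod complexNormal) =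
        (1 - σ * v)⁻¹ * cexp (σ / (1 - σ * v) * (ω₀ ^ 2 : ℝ) * ξ) := by
      rw [integral_prod _ (Integrable.of_bound
        (by exact
          (hmeas.comp (measurable_prodMk_left.comp measurable_prodMk_left)).aestronglyMeasurable) 1
        (ae_of_all _ fun p ↦ norm_cexp_mul_ofReal_le hσ (sq_nonneg _)))]
      have hG₂ (G₁ : ℂ) : ∫ G₂, cexp (σ *
            (‖partialSignal ω₀ ω₁ ω₂ z (ξ, φ, G₁, G₂)‖ ^ 2 : ℝ)) ∂complexNormal =
          (1 - σ * k)⁻¹ * cexp (σ / (1 - σ * k) *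
            (‖ω₀ * √ξ * cexp (φ * I) + ω₁ * G₁‖ ^ 2 : ℝ)) := by
        have := integral_cexp_complexNormal hσ (ω₀ * √ξ * cexp (φ * I) + ω₁ * G₁) (ω₂ * z)
        rw [norm_mul, mul_pow, norm_real, Real.norm_eq_abs, sq_abs] at this
        rw [← this]
        refine integral_congr_ae (ae_of_all _ fun G₂ ↦ ?_)
        simp only [partialSignal, signal]
        rw [mul_right_comm (ω₂ : ℂ) G₂ z]
      simp_rw [hG₂]
      rw [integral_const_mul, integral_cexp_complexNormal hσ1, norm_real, Real.norm_eq_abs, sq_abs,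
        norm_mul, norm_mul, norm_real, norm_real, norm_exp_ofReal_mul_I, mul_one, mul_pow,
        Real.norm_eq_abs, Real.norm_eq_abs, sq_abs, sq_abs, Real.sq_sqrt hξ, ← mul_assoc]
      have e : (1 - σ * k) * (1 - σ / (1 - σ * k) * (ω₁ ^ 2 : ℝ)) = 1 - σ * v := by
        rw [hv]
        field_simp
        push_cast
        ring
      rw [← mul_inv, e, div_div, e, ofReal_mul, ← mul_assoc]
    simp_rw [hφ]
    simp
  rw [partialSourceLaw] at hint ⊢
  rw [integral_prod _ hint]
  obtain ⟨n, rfl⟩ : ∃ n, m = n + 1 := ⟨m - 1, by omega⟩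
  have hσ2 : (σ / (1 - σ * v) * (ω₀ ^ 2 : ℝ)).re ≤ 0 := by
    rw [re_mul_ofReal]
    exact mul_nonpos_of_nonpos_of_nonneg (re_div_one_sub_mul_nonpos hσ hv0) (sq_nonneg _)
  have hL := integral_cexp_gammaMeasure n.succ_pos hm0 hσ2
  have : ∫ ξ : ℝ, ∫ p : ℝ × ℂ × ℂ, cexp (σ * (‖partialSignal ω₀ ω₁ ω₂ z (ξ, p)‖ ^ 2 : ℝ))
        ∂(uniformPhase.prod (complexNormal.prod complexNormal))
        ∂gammaMeasure (n + 1 : ℕ) (n + 1 : ℕ) =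
      ∫ ξ : ℝ, (1 - σ * v)⁻¹ * cexp (σ / (1 - σ * v) * (ω₀ ^ 2 : ℝ) * ξ)
        ∂gammaMeasure (n + 1 : ℕ) (n + 1 : ℕ) := by
    rw [integral_gammaMeasure_natCast n hm0, integral_gammaMeasure_natCast n hm0]
    refine setIntegral_congr_fun measurableSet_Ioi fun ξ hξ ↦ ?_
    rw [hinner ξ (le_of_lt hξ)]
  rw [this, integral_const_mul, hL]
  have e : 1 - σ / (1 - σ * v) * (ω₀ ^ 2 : ℝ) / ((n + 1 : ℕ) : ℝ) = (1 - σ * w) / (1 - σ * v) := by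
    rw [ofReal_natCast, hw]
    field_simp
    push_cast
    field_simp
    ring
  rw [e, div_pow, inv_div, Nat.add_sub_cancel, pow_succ (1 - σ * (v : ℂ))]
  field_simp

/-- For a frozen value `z ≠ 0` of `G₃`, the law of `|S|²` is a binomial mixture of Gamma laws of
integer shapes. -/
lemma map_partialSignal_eq_sum {m : ℕ} (hm : 0 < m) (ω₀ ω₁ ω₂ : ℝ) (z : ℂ) {v w : ℝ}
    (hv : v = ω₁ ^ 2 + ω₂ ^ 2 * ‖z‖ ^ 2) (hw : w = v + ω₀ ^ 2 / m) (hw0 : 0 < w) :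
    (partialSourceLaw m).map (fun p ↦ ‖partialSignal ω₀ ω₁ ω₂ z p‖ ^ 2) =
      ∑ j ∈ Finset.range m, ENNReal.ofReal
        (((m - 1).choose j : ℝ) * (v / w) ^ j * (1 - v / w) ^ (m - 1 - j)) •
          gammaMeasure (m - j : ℕ) w⁻¹ := by
  have hm0 : (0 : ℝ) < m := by exact_mod_cast hm
  have := isProbabilityMeasure_partialSourceLaw hm0
  have hv0 : 0 ≤ v := by rw [hv]; positivity
  have hvw : 0 ≤ 1 - v / w := by
    rw [sub_nonneg, div_le_one hw0, hw]
    have : 0 ≤ ω₀ ^ 2 / m := by positivity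
    linarith
  have hfin (j : ℕ) (hj : j ∈ Finset.range m) :
      IsProbabilityMeasure (gammaMeasure (m - j : ℕ) w⁻¹) :=
    isProbabilityMeasure_gammaMeasure
      (by exact_mod_cast Nat.sub_pos_of_lt (Finset.mem_range.1 hj)) (inv_pos.2 hw0)
  have : IsFiniteMeasure (∑ j ∈ Finset.range m, ENNReal.ofReal
        (((m - 1).choose j : ℝ) * (v / w) ^ j * (1 - v / w) ^ (m - 1 - j)) •
          gammaMeasure (m - j : ℕ) w⁻¹) := by
    refine ⟨?_⟩
    rw [Measure.finsetSum_apply]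
    refine ENNReal.sum_lt_top.2 fun j hj ↦ ?_
    have := hfin j hj
    simp [ENNReal.ofReal_lt_top]
  refine Measure.ext_of_charFun (funext fun t ↦ ?_)
  have hσ : (t * I : ℂ).re ≤ 0 := by simp
  rw [charFun_apply_real, charFun_apply_real, integral_map (by fun_prop) (by fun_prop),
    integral_finsetSum_measure]
  · have e1 (x : ℝ) : cexp (t * x * I) = cexp ((t * I) * x) := by congr 1; ring
    simp_rw [e1]
    rw [integral_cexp_partialSignal hm ω₀ ω₁ ω₂ z hσ hv hw]
    have n1 := one_sub_mul_ofReal_ne_zero hσ hw0.le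
    have hwC : (w : ℂ) ≠ 0 := by exact_mod_cast hw0.ne'
    have e2 : (1 - t * I * v : ℂ) = (v / w) * (1 - t * I * w) + (1 - v / w) := by
      field_simp
      ring
    rw [e2, add_pow, Finset.sum_div, Nat.sub_add_cancel hm]
    refine Finset.sum_congr rfl fun j hj ↦ ?_
    have hj := Finset.mem_range.1 hj
    rw [integral_smul_measure, integral_cexp_gammaMeasure (Nat.sub_pos_of_lt hj) (inv_pos.2 hw0) hσ,
      ENNReal.toReal_ofReal (by positivity), Complex.real_smul, ofReal_inv, div_inv_eq_mul]
    have e3 : (1 - t * I * w : ℂ) ^ m = (1 - t * I * w) ^ j * (1 - t * I * w) ^ (m - j) := by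
      rw [← pow_add]
      congr 1
      omega
    rw [e3, mul_pow]
    push_cast
    generalize (1 - t * I * w : ℂ) = y at n1
    field_simp
  · intro j hj
    have := hfin j hj
    refine Integrable.smul_measure ?_ ENNReal.ofReal_ne_top
    refine Integrable.of_bound (by fun_prop) 1 (ae_of_all _ fun x ↦ ?_)
    rw [← ofReal_mul, norm_exp_ofReal_mul_I]

/-- The conditional tail of `|S|²` given `G₃ = z`. -/
lemma partialSourceLaw_real_lt {m : ℕ} (hm : 0 < m) (ω₀ ω₁ ω₂ : ℝ) (z : ℂ) {v w : ℝ}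
    (hv : v = ω₁ ^ 2 + ω₂ ^ 2 * ‖z‖ ^ 2) (hw : w = v + ω₀ ^ 2 / m) (hw0 : 0 < w)
    {g : ℝ} (hg : 0 ≤ g) :
    (partialSourceLaw m).real {p | g < ‖partialSignal ω₀ ω₁ ω₂ z p‖ ^ 2} =
      ∑ j ∈ Finset.range m, ((m - 1).choose j : ℝ) * (v / w) ^ j * (1 - v / w) ^ (m - 1 - j) *
        (Real.exp (-(w⁻¹ * g)) *
          ∑ r ∈ Finset.range (m - j), (w⁻¹ * g) ^ r / (r.factorial : ℝ)) := by
  have hv0 : 0 ≤ v := by rw [hv]; positivity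
  have hvw : 0 ≤ 1 - v / w := by
    rw [sub_nonneg, div_le_one hw0, hw]
    have : 0 ≤ ω₀ ^ 2 / m := by positivity
    linarith
  have h1 : (partialSourceLaw m).real {p | g < ‖partialSignal ω₀ ω₁ ω₂ z p‖ ^ 2} =
      ((partialSourceLaw m).map (fun p ↦ ‖partialSignal ω₀ ω₁ ω₂ z p‖ ^ 2)).real (Set.Ioi g) := by
    rw [map_measureReal_apply (by fun_prop) measurableSet_Ioi]
    rfl
  rw [h1, map_partialSignal_eq_sum hm ω₀ ω₁ ω₂ z hv hw hw0, measureReal_def,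
    Measure.finsetSum_apply, ENNReal.toReal_sum]
  · refine Finset.sum_congr rfl fun j hj ↦ ?_
    rw [Measure.smul_apply, smul_eq_mul, ENNReal.toReal_mul,
      ENNReal.toReal_ofReal (by positivity), ← measureReal_def,
      gammaMeasure_real_Ioi (Nat.sub_pos_of_lt (Finset.mem_range.1 hj)) (inv_pos.2 hw0) hg]
  · intro j hj
    have : IsProbabilityMeasure (gammaMeasure (m - j : ℕ) w⁻¹) :=
      isProbabilityMeasure_gammaMeasure
        (by exact_mod_cast Nat.sub_pos_of_lt (Finset.mem_range.1 hj)) (inv_pos.2 hw0)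
    exact ENNReal.mul_ne_top ENNReal.ofReal_ne_top (measure_ne_top _ _)

/-! ### The tail of `|S|²` -/

/-- The squared modulus of a standard complex normal variable is a standard exponential variable. -/
lemma map_norm_sq_complexNormal :
    complexNormal.map (fun z ↦ ‖z‖ ^ 2) = gammaMeasure (1 : ℕ) 1 := by
  have : IsProbabilityMeasure (gammaMeasure (1 : ℕ) 1) :=
    isProbabilityMeasure_gammaMeasure (by simp) one_pos
  have : IsProbabilityMeasure (complexNormal.map (fun z ↦ ‖z‖ ^ 2)) :=
    Measure.isProbabilityMeasure_map (by fun_prop)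
  refine Measure.ext_of_charFun (funext fun t ↦ ?_)
  have hσ : (t * I : ℂ).re ≤ 0 := by simp
  rw [charFun_apply_real, charFun_apply_real, integral_map (by fun_prop) (by fun_prop)]
  have e1 (x : ℝ) : cexp (t * x * I) = cexp ((t * I) * x) := by congr 1; ring
  simp_rw [e1]
  rw [integral_cexp_gammaMeasure one_pos one_pos hσ]
  simpa using integral_cexp_complexNormal hσ 0 1

/-- The tail of `|S|²` as an average of conditional tails over `|G₃|²`, a standard exponential
variable. -/
lemma sourceLaw_real_lt {m : ℕ} (hm : 0 < m) (ω₀ ω₁ ω₂ : ℝ) (hω₂ : ω₂ ≠ 0) {g : ℝ} (hg : 0 ≤ g)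
    {v w : ℝ → ℝ} (hv : ∀ x, v x = ω₁ ^ 2 + ω₂ ^ 2 * x) (hw : ∀ x, w x = v x + ω₀ ^ 2 / m) :
    (sourceLaw m).real {p | g < ‖signal ω₀ ω₁ ω₂ p‖ ^ 2} =
      ∫ x in Set.Ioi 0, Real.exp (-x) * ∑ j ∈ Finset.range m,
        ((m - 1).choose j : ℝ) * (v x / w x) ^ j * (1 - v x / w x) ^ (m - 1 - j) *
          (Real.exp (-((w x)⁻¹ * g)) *
            ∑ r ∈ Finset.range (m - j), ((w x)⁻¹ * g) ^ r / (r.factorial : ℝ)) := by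
  have hm0 : (0 : ℝ) < m := by exact_mod_cast hm
  have := isProbabilityMeasure_partialSourceLaw hm0
  set H : ℝ → ℝ := fun x ↦ ∑ j ∈ Finset.range m,
        ((m - 1).choose j : ℝ) * (v x / w x) ^ j * (1 - v x / w x) ^ (m - 1 - j) *
          (Real.exp (-((w x)⁻¹ * g)) *
            ∑ r ∈ Finset.range (m - j), ((w x)⁻¹ * g) ^ r / (r.factorial : ℝ)) with hH
  have hvm : Measurable v := by rw [funext hv]; fun_prop
  have hwm : Measurable w := by rw [funext hw]; fun_prop
  have hHm : Measurable H := by rw [hH]; fun_prop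
  have hS : MeasurableSet {p | g < ‖signal ω₀ ω₁ ω₂ p‖ ^ 2} :=
    measurableSet_lt measurable_const (by fun_prop)
  have hpos : ∀ᵐ z ∂complexNormal, ‖z‖ ^ 2 ≠ 0 := by
    have h : ∀ᵐ x ∂(complexNormal.map (fun z ↦ ‖z‖ ^ 2)), x ≠ 0 := by
      rw [map_norm_sq_complexNormal]
      exact (withDensity_absolutelyContinuous _ _).ae_le (Measure.ae_ne volume 0)
    exact ae_of_ae_map (f := fun z : ℂ ↦ ‖z‖ ^ 2) (by fun_prop) h
  have hmp := measurePreserving_partialSourceLaw hm0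
  have key : (sourceLaw m).real {p | g < ‖signal ω₀ ω₁ ω₂ p‖ ^ 2} =
      ∫ z, (partialSourceLaw m).real {p | g < ‖partialSignal ω₀ ω₁ ω₂ z p‖ ^ 2}
        ∂complexNormal := by
    rw [measureReal_def, ← hmp.measure_preimage hS.nullMeasurableSet,
      Measure.prod_apply (hmp.measurable hS)]
    refine Eq.trans ?_ (integral_eq_lintegral_of_nonneg_ae (ae_of_all _ fun _ ↦ measureReal_nonneg)
        (measurable_measure_prodMk_left (hmp.measurable hS)).ennreal_toReal.aestronglyMeasurable).symm
    congr 1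
    refine lintegral_congr fun z ↦ ?_
    rw [ofReal_measureReal]
  have h2 : ∫ z, (partialSourceLaw m).real {p | g < ‖partialSignal ω₀ ω₁ ω₂ z p‖ ^ 2}
        ∂complexNormal = ∫ z, H (‖z‖ ^ 2) ∂complexNormal := by
    refine integral_congr_ae ?_
    filter_upwards [hpos] with z hz
    refine partialSourceLaw_real_lt hm ω₀ ω₁ ω₂ z (hv _) (hw _) ?_ hg
    rw [hw, hv]
    positivity
  rw [key, h2, ← integral_map (φ := fun z : ℂ ↦ ‖z‖ ^ 2) (by fun_prop) hHm.aestronglyMeasurable,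
    map_norm_sq_complexNormal, integral_gammaMeasure_natCast 0 one_pos]
  simp [hH]

end Transforms

/-! ### Generalized incomplete Gamma integrals -/

lemma continuousOn_genIncGammaIntegrand (a b : ℝ) :
    ContinuousOn (genIncGammaIntegrand a b) (Set.Ioi 0) := by
  unfold genIncGammaIntegrand
  intro x hx
  have hx0 : x ≠ 0 := ne_of_gt hx
  refine ContinuousAt.continuousWithinAt ?_
  have := Real.continuousAt_rpow_const x (a - 1) (Or.inl hx0)
  have h2 : ContinuousAt (fun t ↦ -b / t) x := continuousAt_const.div continuousAt_id hx0
  exact (this.mul (by fun_prop)).mul h2.rexp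

/-- Away from the origin the factor `e^{-t}` alone makes the integrand integrable. -/
lemma integrableOn_genIncGammaIntegrand_of_pos (a : ℝ) {b c : ℝ} (hb : 0 ≤ b) (hc : 0 < c) :
    IntegrableOn (genIncGammaIntegrand a b) (Set.Ioi c) := by
  refine integrable_of_isBigO_exp_neg one_half_pos
    ((continuousOn_genIncGammaIntegrand a b).mono fun x hx ↦ hc.trans_le hx) ?_
  refine Asymptotics.IsBigO.trans ?_ (Real.Gamma_integrand_isLittleO (a - 1)).isBigO
  refine Asymptotics.IsBigO.of_bound 1 ?_
  filter_upwards [eventually_gt_atTop 0] with x hx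
  rw [genIncGammaIntegrand, one_mul, norm_mul, mul_comm (x ^ (a - 1))]
  refine mul_le_of_le_one_right (norm_nonneg _) ?_
  rw [Real.norm_eq_abs, Real.abs_exp, Real.exp_le_one_iff, neg_div]
  have : 0 ≤ b / x := by positivity
  linarith

/-- The generalized incomplete Gamma integral converges if `c` or `b` is positive. For `b > 0` the
factor `e^{-b/t}` beats every power of `t` at the origin. -/
lemma integrableOn_genIncGammaIntegrand (a : ℝ) {b c : ℝ} (hb : 0 ≤ b) (hc : 0 ≤ c)
    (h : 0 < c ∨ 0 < b) : IntegrableOn (genIncGammaIntegrand a b) (Set.Ioi c) := by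
  rcases h with h | h
  · exact integrableOn_genIncGammaIntegrand_of_pos a hb h
  refine IntegrableOn.mono_set (t := Set.Ioi 0) ?_ (Set.Ioi_subset_Ioi hc)
  rw [← Set.Ioc_union_Ioi_eq_Ioi zero_le_one, integrableOn_union]
  refine ⟨?_, integrableOn_genIncGammaIntegrand_of_pos a hb one_pos⟩
  obtain ⟨n, hn⟩ := exists_nat_ge (1 - a)
  refine Measure.integrableOn_of_bounded (M := n.factorial / b ^ n) measure_Ioc_lt_top.ne
    (Measurable.aestronglyMeasurable (by unfold genIncGammaIntegrand; fun_prop)) ?_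
  refine (ae_restrict_iff' measurableSet_Ioc).2 (ae_of_all _ fun t ht ↦ ?_)
  obtain ⟨ht0, ht1⟩ := ht
  have hbt : 0 < b / t := by positivity
  rw [genIncGammaIntegrand, Real.norm_of_nonneg (by positivity)]
  -- `e^{-y} ≤ n! / yⁿ` with `y = b / t` and `n ≥ 1 - a`
  have h1 : Real.exp (-b / t) ≤ n.factorial / (b / t) ^ n := by
    rw [neg_div, Real.exp_neg, inv_le_comm₀ (Real.exp_pos _) (by positivity), inv_div]
    exact Real.pow_div_factorial_le_exp _ hbt.le n
  have h2 : Real.exp (-t) ≤ 1 := Real.exp_le_one_iff.2 (by linarith)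
  have h3 : t ^ (a - 1) * t ^ n ≤ 1 := by
    rw [← Real.rpow_natCast, ← Real.rpow_add ht0]
    exact Real.rpow_le_one ht0.le ht1 (by linarith)
  calc t ^ (a - 1) * Real.exp (-t) * Real.exp (-b / t)
      ≤ t ^ (a - 1) * 1 * (n.factorial / (b / t) ^ n) := by gcongr
    _ = (t ^ (a - 1) * t ^ n) * (n.factorial / b ^ n) := by
        rw [div_pow]
        field_simp
    _ ≤ 1 * (n.factorial / b ^ n) := by gcongr
    _ = _ := one_mul _

lemma integrableOn_genIncGammaIntegrand_one_zero :
    IntegrableOn (genIncGammaIntegrand 1 0) (Set.Ioi 0) := by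
  refine (Real.GammaIntegral_convergent one_pos).congr_fun (fun x _ ↦ ?_) measurableSet_Ioi
  simp [genIncGammaIntegrand]

/-- With `w = α t` and `v = w - d`, the exponential density times the conditional tail is a
combination of integrands of generalized incomplete Gamma functions. -/
lemma exp_mul_sum_eq_sum_genIncGammaIntegrand {m : ℕ} {α d c g t : ℝ} (hα : 0 < α) (ht : 0 < t) :
    Real.exp (-(t - c)) * ∑ j ∈ Finset.range m,
        ((m - 1).choose j : ℝ) * ((α * t - d) / (α * t)) ^ j *
          (1 - (α * t - d) / (α * t)) ^ (m - 1 - j) *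
          (Real.exp (-((α * t)⁻¹ * g)) *
            ∑ r ∈ Finset.range (m - j), ((α * t)⁻¹ * g) ^ r / (r.factorial : ℝ)) =
      ∑ j ∈ Finset.range m, ∑ r ∈ Finset.range (m - j), ∑ q ∈ Finset.range (j + 1),
        Real.exp c * (((m - 1).choose j : ℝ) * (j.choose q : ℝ) *
          ((-1) ^ (j - q) * α ^ ((q : ℤ) - r - m + 1) / (r.factorial : ℝ)) *
          g ^ r * d ^ (m - q - 1)) *
          genIncGammaIntegrand ((q : ℝ) - r - m + 2) (g / α) t := by
  rw [Finset.mul_sum]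
  refine Finset.sum_congr rfl fun j hj ↦ ?_
  have hj := Finset.mem_range.1 hj
  rw [Finset.mul_sum, Finset.mul_sum, Finset.mul_sum]
  refine Finset.sum_congr rfl fun r _ ↦ ?_
  have hw : α * t ≠ 0 := by positivity
  have e1 : 1 - (α * t - d) / (α * t) = d / (α * t) := by field_simp; ring
  have e2 : (α * t - d) ^ j = ∑ q ∈ Finset.range (j + 1),
      (α * t) ^ q * ((-1) ^ (j - q) * d ^ (j - q)) * (j.choose q : ℝ) := by
    rw [sub_eq_add_neg, add_pow]
    refine Finset.sum_congr rfl fun q _ ↦ ?_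
    rw [neg_pow d]
  rw [e1, div_pow (α * t - d), e2, Finset.sum_div]
  simp_rw [Finset.mul_sum, Finset.sum_mul, Finset.mul_sum]
  refine Finset.sum_congr rfl fun q hq ↦ ?_
  have hq := Finset.mem_range.1 hq
  have e3 : t ^ ((q : ℝ) - r - m + 2 - 1) = t ^ ((q : ℤ) - r - m + 1) := by
    rw [← Real.rpow_intCast]
    congr 1
    push_cast
    ring
  have e4 : Real.exp (-(t - c)) = Real.exp c * Real.exp (-t) := by
    rw [← Real.exp_add]
    congr 1
    ring
  have e5 : -((α * t)⁻¹ * g) = -(g / α) / t := by field_simp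
  have e6 : d ^ (m - q - 1) = d ^ (j - q) * d ^ (m - 1 - j) := by
    rw [← pow_add]
    congr 1
    omega
  have e7 : (α * t) ^ ((q : ℤ) - r - m + 1) * (α * t) ^ j * (α * t) ^ (m - 1 - j) * (α * t) ^ r =
      (α * t) ^ q := by
    simp_rw [← zpow_natCast]
    rw [← zpow_add₀ hw, ← zpow_add₀ hw, ← zpow_add₀ hw]
    congr 1
    omega
  rw [genIncGammaIntegrand, e3, e4, e5, e6, ← e7, div_pow, mul_pow _ g, inv_pow, mul_zpow]
  field_simp

end FSOSF

/-! ### The distribution function -/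

theorem lemma2 {Ω : Type*} [MeasurableSpace Ω] (μ : Measure Ω) [IsProbabilityMeasure μ]
    (X : Ω → ℝ) (α β γbar : ℝ) (m : ℕ) (hm : 0 < m) (hα : 0 < α) (hγbar : 0 < γbar)
    (hX : FSOSF.IsFSOSF α β (m : ℝ) γbar X μ) (γ : ℝ) (hγ : 0 ≤ γ) :
    ((α < 1 ∨ 0 < γ) →
      ∀ j ∈ Finset.range m, ∀ r ∈ Finset.range (m - j), ∀ q ∈ Finset.range (j + 1),
        IntegrableOn
          (FSOSF.genIncGammaIntegrand ((q : ℝ) - r - m + 2) (γ / (α * γbar)))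
          (Set.Ioi ((m * (1 - α - β) + β) / (m * α)))) ∧
    cdf (μ.map X) γ =
      1 - Real.exp ((m * (1 - α - β) + β) / (m * α)) *
        ∑ j ∈ Finset.range m, ∑ r ∈ Finset.range (m - j), ∑ q ∈ Finset.range (j + 1),
          ((m - 1).choose j : ℝ) * (j.choose q : ℝ) *
            ((-1) ^ (j - q) * α ^ ((q : ℤ) - r - m + 1) / (r.factorial : ℝ)) *
            (γ / γbar) ^ r * (β / m) ^ (m - q - 1) *
            FSOSF.genIncGamma ((q : ℝ) - r - m + 2)
              ((m * (1 - α - β) + β) / (m * α)) (γ / (α * γbar)) := by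
  obtain ⟨ω₀, ω₁, ω₂, hω, hα', hβ', hlaw⟩ := hX
  rw [hω, div_one] at hα' hβ'
  have hm0 : (0 : ℝ) < m := by exact_mod_cast hm
  have hω₁ : ω₁ ^ 2 = 1 - α - β := by rw [hα', hβ']; linarith
  have hβ0 : 0 ≤ β := hβ' ▸ sq_nonneg ω₀
  have hδ0 : 0 ≤ 1 - α - β := hω₁ ▸ sq_nonneg ω₁
  have hω₂ : ω₂ ≠ 0 := by
    rintro rfl
    simp [hα'] at hα
  have hg0 : 0 ≤ γ / γbar := by positivity
  have hb : γ / (α * γbar) = γ / γbar / α := by rw [div_div, mul_comm]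
  set c : ℝ := (m * (1 - α - β) + β) / (m * α) with hc
  have hc0 : 0 ≤ c := by positivity
  have hcα : α * c = 1 - α - β + β / m := by
    rw [hc]
    field_simp
  have hconv (h : α < 1 ∨ 0 < γ) (a : ℝ) :
      IntegrableOn (FSOSF.genIncGammaIntegrand a (γ / (α * γbar))) (Set.Ioi c) := by
    refine FSOSF.integrableOn_genIncGammaIntegrand a (by positivity) hc0 ?_
    rcases h with h | h
    · left
      refine div_pos ?_ (by positivity)
      rcases hβ0.eq_or_lt with h0 | h0
      · rw [← h0]
        have : 0 < 1 - α - 0 := by linarith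
        positivity
      · positivity
    · right
      positivity
  refine ⟨fun h j _ r _ q _ ↦ hconv h _, ?_⟩
  have : IsProbabilityMeasure (μ.map X) := Measure.isProbabilityMeasure_map hlaw.aemeasurable
  have := FSOSF.isProbabilityMeasure_sourceLaw hm0
  -- the distribution function is one minus the tail of `|S|²` at `g = γ / γbar`
  have htail : cdf (μ.map X) γ =
      1 - (FSOSF.sourceLaw m).real {p | γ / γbar < ‖FSOSF.signal ω₀ ω₁ ω₂ p‖ ^ 2} := by
    rw [cdf_eq_real, ← compl_compl (Set.Iic γ), probReal_compl_eq_one_sub measurableSet_Iic.compl,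
      Set.compl_Iic, hlaw.map_eq, FSOSF.snrLaw,
      map_measureReal_apply (by fun_prop) measurableSet_Ioi]
    congr 2
    ext p
    exact (div_lt_iff₀' hγbar).symm
  rw [htail, FSOSF.sourceLaw_real_lt (v := fun x ↦ α * (x + c) - β / m) (w := fun x ↦ α * (x + c))
    hm ω₀ ω₁ ω₂ hω₂ hg0 (fun x ↦ ?_) (fun x ↦ ?_)]
  rotate_left
  · rw [hω₁, ← hα', mul_add, hcα]
    ring
  · rw [← hβ']
    ring
  congr 1
  -- the substitution `t = x + c`
  have hshift (f : ℝ → ℝ) : ∫ x in Set.Ioi 0, f (x + c) = ∫ t in Set.Ioi c, f t := by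
    have := (measurePreserving_add_right volume c).setIntegral_preimage_emb
      (measurableEmbedding_addRight c) f (Set.Ioi c)
    rwa [Set.preimage_add_const_Ioi, sub_self] at this
  have hterm (x : ℝ) (hx : x ∈ Set.Ioi 0) := FSOSF.exp_mul_sum_eq_sum_genIncGammaIntegrand
    (m := m) (d := β / m) (c := c) (g := γ / γbar) hα (add_pos_of_pos_of_nonneg hx hc0)
  simp only [add_sub_cancel_right] at hterm
  rw [setIntegral_congr_fun measurableSet_Ioi hterm,
    hshift (fun t ↦ ∑ j ∈ Finset.range m, ∑ r ∈ Finset.range (m - j), ∑ q ∈ Finset.range (j + 1),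
      Real.exp c * (((m - 1).choose j : ℝ) * (j.choose q : ℝ) *
        ((-1) ^ (j - q) * α ^ ((q : ℤ) - r - m + 1) / (r.factorial : ℝ)) *
        (γ / γbar) ^ r * (β / m) ^ (m - q - 1)) *
        FSOSF.genIncGammaIntegrand ((q : ℝ) - r - m + 2) (γ / γbar / α) t)]
  -- a term with a divergent integral has a zero coefficient: divergence forces `α = 1`, hence
  -- `β = 0`, so that only `q = j = m - 1`, `r = 0` survives
  have hint (j : ℕ) (hj : j ∈ Finset.range m) (r : ℕ) (hr : r ∈ Finset.range (m - j)) (q : ℕ)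
      (hq : q ∈ Finset.range (j + 1)) : IntegrableOn (fun t ↦
        Real.exp c * (((m - 1).choose j : ℝ) * (j.choose q : ℝ) *
        ((-1) ^ (j - q) * α ^ ((q : ℤ) - r - m + 1) / (r.factorial : ℝ)) *
        (γ / γbar) ^ r * (β / m) ^ (m - q - 1)) *
        FSOSF.genIncGammaIntegrand ((q : ℝ) - r - m + 2) (γ / γbar / α) t) (Set.Ioi c) := by
    rw [Finset.mem_range] at hj hr hq
    by_cases h : α < 1 ∨ 0 < γ
    · rw [← hb]
      exact (hconv h _).const_mul _
    · push Not at h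
      have hα1 : α = 1 := by linarith
      have hβz : β = 0 := by linarith
      have hγz : γ = 0 := le_antisymm h.2 hγ
      by_cases hqm : m - q - 1 = 0
      · obtain rfl : j = q := by omega
        obtain rfl : r = 0 := by omega
        have ha : (j : ℝ) - (0 : ℕ) - m + 2 = 1 := by
          have : (m : ℝ) = j + 1 := by exact_mod_cast (by omega : m = j + 1)
          rw [this]
          push_cast
          ring
        have hcz : c = 0 := by rw [hc, hα1, hβz]; simp
        rw [ha, hγz, hcz, zero_div, zero_div]
        exact FSOSF.integrableOn_genIncGammaIntegrand_one_zero.const_mul _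
      · simp [hβz, zero_pow hqm]
  rw [integral_finsetSum _ fun j hj ↦ integrable_finsetSum _ fun r hr ↦
    integrable_finsetSum _ fun q hq ↦ hint j hj r hr q hq, Finset.mul_sum]
  refine Finset.sum_congr rfl fun j hj ↦ ?_
  rw [integral_finsetSum _ fun r hr ↦ integrable_finsetSum _ fun q hq ↦ hint j hj r hr q hq,
    Finset.mul_sum]
  refine Finset.sum_congr rfl fun r hr ↦ ?_
  rw [integral_finsetSum _ fun q hq ↦ hint j hj r hr q hq, Finset.mul_sum]
  refine Finset.sum_congr rfl fun q hq ↦ ?_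
  rw [integral_const_mul, FSOSF.genIncGamma, hb, mul_assoc (Real.exp c)]
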